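/- Let $n\ge 1$ and let $X=(\mathbb{R}^n,\|\cdot\|)$ be a normed space whose norm is symmetric, i.e. $\|(x_1,\dots,x_n)\|=\|(x_{\sigma(1)},\dots,x_{\sigma(n)})\|=\|(\delta_1x_1,\dots,\delta_nx_n)\|$ for all $x\in\mathbb{R}^n$, all permutations $\sigma$ of $\{1,\dots,n\}$ and all $\delta_1,\dots,\delta_n\in\{-1,1\}$. Suppose that $X$ is smooth, i.e. for every $x_0$ with $\|x_0\|=1$ there is exactly one linear functional $f$ with $f(x_0)=1$ and $|f(x)|\le 1$ whenever $\|x\|\le 1$. For $t>0$ let $$\rho_X(t)=\sup\left\{\frac{\|x+ty\|+\|x-ty\|}{2}-1 : \|x\|,\|y\|\le 1\right\}$$ be the modulus of smoothness of $X$. For a normed space $Y$, let $d(X,Y)=\inf_T\|T\|\cdot\|T^{-1}\|$ be the Banach–Mazur distance, where $T$ runs over the linear isomorphisms $X\to Y$ ($d(X,Y)=\infty$ if there are none), and let $e(Y)$ be the equilateral dimension of $Y$, the maximal cardinality of a set $S\subset Y$ for which there is $p>0$ with $\|x-y\|=p$ for all distinct $x,y\in S$. Then there is $\varepsilon_0>0$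 with $\frac{\rho_X(\varepsilon_0)}{\varepsilon_0}\le\frac1{6n}$, and there is a number $R(X)>1$ such that $e(Y)\ge n$ for every real normed space $Y$ with $d(X,Y)\le R(X)$, and such that $R(X)\ge 1+\frac{\varepsilon_0}{6n}$ for every $\varepsilon_0>0$ satisfying $\frac{\rho_X(\varepsilon_0)}{\varepsilon_0}\le\frac{1}{6n}$. -/

import Mathlib

open scoped ENNReal

noncomputable section

/-- A set is equilateral if all distances between distinct points equal one common `p > 0`. -/
def IsEquilateral {Y : Type*} [NormedAddCommGroup Y] (S : Set Y) : Prop :=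
  ∃ p : ℝ, 0 < p ∧ ∀ x ∈ S, ∀ y ∈ S, x ≠ y → ‖x - y‖ = p

/-- The equilateral dimension `e(Y)`: the largest cardinality of an equilateral set, with values
in `ℕ ∪ {∞}`. -/
def equilateralDim (Y : Type*) [NormedAddCommGroup Y] : ℕ∞ :=
  ⨆ (S : Set Y) (_ : IsEquilateral S), S.encard

/-- The multiplicative Banach–Mazur distance, the infimum of `‖T‖ * ‖T⁻¹‖` over all linear
isomorphisms `T : X → Y`. It takes values in `[0, ∞]`, and it is `∞` if there is no
isomorphism. -/
def banachMazurDist (X Y : Type*) [NormedAddCommGroup X] [NormedSpace ℝ X]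
    [NormedAddCommGroup Y] [NormedSpace ℝ Y] : ℝ≥0∞ :=
  ⨅ T : X ≃L[ℝ] Y, ENNReal.ofReal (‖(T : X →L[ℝ] Y)‖ * ‖(T.symm : Y →L[ℝ] X)‖)

/-- The norm of `X`, written in the coordinates given by the basis `b` (so that `X` is `ℝⁿ` with
a norm and `b` is the standard basis), is invariant under permutations of the coordinates. -/
def IsPermutationInvariant {n : ℕ} {X : Type*} [NormedAddCommGroup X] [NormedSpace ℝ X]
    (b : Module.Basis (Fin n) ℝ X) : Prop :=
  ∀ (σ : Equiv.Perm (Fin n)) (x : Fin n → ℝ), ‖∑ i, x i • b i‖ = ‖∑ i, x (σ i) • b i‖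

/-- The norm of `X`, written in the coordinates given by the basis `b`, is invariant under
changes of the signs of the coordinates. -/
def IsOneUnconditional {n : ℕ} {X : Type*} [NormedAddCommGroup X] [NormedSpace ℝ X]
    (b : Module.Basis (Fin n) ℝ X) : Prop :=
  ∀ (ε : Fin n → ℝ), (∀ i, ε i = 1 ∨ ε i = -1) →
    ∀ x : Fin n → ℝ, ‖∑ i, x i • b i‖ = ‖∑ i, (ε i * x i) • b i‖

/-- Symmetric: permutation-invariant and `1`-unconditional. -/
def IsSymmetricNorm {n : ℕ} {X : Type*} [NormedAddCommGroup X] [NormedSpace ℝ X]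
    (b : Module.Basis (Fin n) ℝ X) : Prop :=
  IsPermutationInvariant b ∧ IsOneUnconditional b

/-- `f` is a supporting functional of the unit ball at `x₀`. -/
def IsSupportingFunctional {X : Type*} [NormedAddCommGroup X] [NormedSpace ℝ X]
    (f : X →L[ℝ] ℝ) (x₀ : X) : Prop :=
  f x₀ = 1 ∧ ∀ x : X, ‖x‖ ≤ 1 → |f x| ≤ 1

/-- Smooth: exactly one supporting functional at each point of the unit sphere. -/
def IsSmoothSpace (X : Type*) [NormedAddCommGroup X] [NormedSpace ℝ X] : Prop :=
  ∀ x₀ : X, ‖x₀‖ = 1 → ∃! f : X →L[ℝ] ℝ, IsSupportingFunctional f x₀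

/-- The modulus of smoothness `ρ_X`, used for `t > 0`. The supremum is over a nonempty set that
is bounded above by `|t|`. -/
def smoothnessModulus (X : Type*) [NormedAddCommGroup X] [NormedSpace ℝ X] (t : ℝ) : ℝ :=
  sSup {r : ℝ | ∃ x y : X, ‖x‖ ≤ 1 ∧ ‖y‖ ≤ 1 ∧ r = (‖x + t • y‖ + ‖x - t • y‖) / 2 - 1}

end

/-! By symmetry the basis vectors `e i` are equidistant in `X`; in a nearby `Y` they are only almost
so. Perturb them to `e i + a i`, with `a` a small symmetric matrix of zero diagonal. The difference
of two of these is `(1 - a i j)` times `e i - e j + u`, with `u` supported off `i, j`, so `a i j`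
acts as a separate stretching parameter for each pair.

Such a `u` matters little: flipping its signs shows that `e i - e j ± u` have equal norm, so that
norm is at least `‖e i - e j‖` and exceeds it at most by the factor `1 + ρ_X(ε)` when `u` is small
(`norm_single_sub_single_le`, `norm_add_zeroCoords_le`). In `Y` each distance is thus a convex
function of `u`, nearly constant on a comparatively large ball, hence with a small Lipschitz
constant on a smaller one. Solving for `a i j` is then a contraction, whose fixed point gives `n`
equidistant points (`exists_equidistant_image`).

A suitable `ε` exists because a smooth finite-dimensional space is uniformly smooth, by compactness.
-/

/-! ### Quantitative bounds for convex functions. -/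

theorem ConvexOn.le_of_norm_le {E : Type*} [NormedAddCommGroup E] [NormedSpace ℝ E] {g : E → ℝ}
    (hg : ConvexOn ℝ Set.univ g) {S r A B : ℝ} (hS : 0 < S) (hr : 0 ≤ r) (hrS : r ≤ S)
    (h0 : g 0 ≤ A) (hB : ∀ w, ‖w‖ ≤ S → g w ≤ B) {w : E} (hw : ‖w‖ ≤ r) :
    g w ≤ A + r / S * (B - A) := by
  rcases hr.eq_or_lt with rfl | hr0
  · have : w = 0 := by simpa using hw
    simp [this, h0]
  have h1 : r / S ≤ 1 := (div_le_one hS).2 hrS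
  have h2 : 0 < r / S := by positivity
  have hz : ‖(S / r) • w‖ ≤ S := by
    rw [norm_smul, Real.norm_of_nonneg (by positivity)]
    calc S / r * ‖w‖ ≤ S / r * r := by gcongr
      _ = S := by field_simp
  have h := hg.2 (Set.mem_univ (0 : E)) (Set.mem_univ ((S / r) • w))
    (sub_nonneg.2 h1) h2.le (by ring)
  have e : (1 - r / S) • (0 : E) + (r / S) • (S / r) • w = w := by
    rw [smul_zero, zero_add, smul_smul]
    have : r / S * (S / r) = 1 := by field_simp
    rw [this, one_smul]
  rw [e] at h
  simp only [smul_eq_mul] at h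
  nlinarith [hB _ hz, mul_le_mul_of_nonneg_left h0 (sub_nonneg.2 h1),
    mul_le_mul_of_nonneg_left (hB _ hz) h2.le]

theorem ConvexOn.sub_le_of_norm_le {E : Type*} [NormedAddCommGroup E] [NormedSpace ℝ E]
    {g : E → ℝ} (hg : ConvexOn ℝ Set.univ g) {S r A B : ℝ} (hrS : r < S)
    (hA : ∀ w, A ≤ g w) (hB : ∀ w, ‖w‖ ≤ S → g w ≤ B) {w w' : E} (hw' : ‖w'‖ ≤ r) :
    g w' - g w ≤ (B - A) / (S - r) * ‖w' - w‖ := by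
  set d := ‖w' - w‖ with hd
  rcases eq_or_ne w' w with rfl | hne
  · simp [hd]
  have hd0 : 0 < d := norm_pos_iff.2 (sub_ne_zero.2 hne)
  have hs : 0 < S - r := sub_pos.2 hrS
  -- Prolong the segment from `w` past `w'` by length `S - r`; this stays in the ball of radius `S`,
  -- and convexity bounds the slope up to `w'` by the slope up to `z`.
  set z := w' + ((S - r) / d) • (w' - w) with hz
  have hzS : ‖z‖ ≤ S := by
    refine (norm_add_le _ _).trans ?_
    rw [norm_smul, Real.norm_of_nonneg (by positivity), ← hd, div_mul_cancel₀ _ hd0.ne']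
    linarith
  set t := d / (d + (S - r)) with ht
  have ht0 : 0 < t := by positivity
  have ht1 : t ≤ 1 := (div_le_one (by positivity)).2 (by linarith)
  have h := hg.2 (Set.mem_univ w) (Set.mem_univ z) (sub_nonneg.2 ht1) ht0.le (by ring)
  have e : (1 - t) • w + t • z = w' := by
    rw [hz]
    have h2 : t + t * ((S - r) / d) = 1 := by rw [ht]; field_simp
    have h3 : (1 - t) • w + t • (w' + ((S - r) / d) • (w' - w))
      = (t + t * ((S - r) / d)) • w' + (1 - (t + t * ((S - r) / d))) • w := by module
    rw [h3, h2]; simp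
  rw [e] at h
  simp only [smul_eq_mul] at h
  have hBA : 0 ≤ B - A := by linarith [hA z, hB z hzS]
  have h5 : t ≤ d / (S - r) := by rw [ht]; gcongr; linarith
  calc g w' - g w ≤ t * (g z - g w) := by linarith
    _ ≤ t * (B - A) := by gcongr; exacts [hB z hzS, hA w]
    _ ≤ d / (S - r) * (B - A) := by gcongr
    _ = _ := by ring

theorem ConvexOn.abs_sub_le_of_norm_le {E : Type*} [NormedAddCommGroup E] [NormedSpace ℝ E]
    {g : E → ℝ} (hg : ConvexOn ℝ Set.univ g) {S r A B : ℝ} (hrS : r < S)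
    (hA : ∀ w, A ≤ g w) (hB : ∀ w, ‖w‖ ≤ S → g w ≤ B) {w w' : E} (hw : ‖w‖ ≤ r)
    (hw' : ‖w'‖ ≤ r) :
    |g w' - g w| ≤ (B - A) / (S - r) * ‖w' - w‖ := by
  rw [abs_le']
  refine ⟨hg.sub_le_of_norm_le hrS hA hB hw', ?_⟩
  rw [neg_sub, norm_sub_rev]
  exact hg.sub_le_of_norm_le hrS hA hB hw

/-! ### The iteration step: invariant ball and contraction. -/

/-- The first-order step of the iteration: the solution `a'` of
`(1 - a') * g ((1 - a)⁻¹ • w) = 1 + 2 * q / 3`. -/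
noncomputable def stretchStep {E : Type*} [AddCommGroup E] [Module ℝ E] (g : E → ℝ) (q : ℝ)
    (a : ℝ) (w : E) : ℝ :=
  1 - (1 + 2 * q / 3) / g ((1 - a)⁻¹ • w)

section StretchStep

variable {E : Type*} [NormedAddCommGroup E] [NormedSpace ℝ E] {g : E → ℝ} {q : ℝ}

theorem norm_inv_one_sub_smul_le (hq : 0 < q) (hq' : q ≤ 1 / 5) {a : ℝ} {w : E}
    (ha : |a| ≤ 2 * q / 3) (hw : ‖w‖ ≤ 4 * q / 3) :
    ‖(1 - a)⁻¹ • w‖ ≤ 4 * q / 3 * (1 + q) := by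
  have h1 : 0 < 1 - a := by linarith [(abs_le.1 ha).2]
  rw [norm_smul, Real.norm_of_nonneg (by positivity), inv_mul_le_iff₀ h1]
  have : 1 ≤ (1 - a) * (1 + q) := by nlinarith [(abs_le.1 ha).2]
  nlinarith

/-- The lower bound uses only `1 ≤ g`. The upper one uses convexity: the argument lies within a
fraction `2 / 9` of the large radius, so only `2 / 9` of the growth `q` is felt, and to first order
`21 / 20 + 2 / 9 < 4 / 3`. -/
theorem abs_stretchStep_le (hg : ConvexOn ℝ Set.univ g) (hq : 0 < q) (hq' : q ≤ 1 / 5)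
    (h1 : ∀ w, 1 ≤ g w) (h0 : g 0 ≤ 1 + 21 / 20 * q)
    (hB : ∀ w, ‖w‖ ≤ 6 * q + 36 * q ^ 2 → g w ≤ (1 + 21 / 20 * q) * (1 + q))
    {a : ℝ} {w : E} (ha : |a| ≤ 2 * q / 3) (hw : ‖w‖ ≤ 4 * q / 3) :
    |stretchStep g q a w| ≤ 2 * q / 3 := by
  have hn := norm_inv_one_sub_smul_le hq hq' ha hw
  have hS : 0 < 6 * q + 36 * q ^ 2 := by positivity
  have hU := hg.le_of_norm_le hS (by positivity) (by nlinarith) h0 hB hn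
  have hθ : 4 * q / 3 * (1 + q) / (6 * q + 36 * q ^ 2) ≤ 2 / 9 := by
    rw [div_le_iff₀ hS]; nlinarith
  have hG := h1 ((1 - a)⁻¹ • w)
  have hU2 : g ((1 - a)⁻¹ • w) ≤ (1 + 21 / 20 * q) * (1 + 2 / 9 * q) := by
    have := mul_le_mul_of_nonneg_right hθ (by positivity : 0 ≤ (1 + 21 / 20 * q) * q)
    nlinarith
  unfold stretchStep
  have hG0 : 0 < g ((1 - a)⁻¹ • w) := by linarith
  rw [abs_le]
  constructor
  · have : (1 + 2 * q / 3) / g ((1 - a)⁻¹ • w) ≤ 1 + 2 * q / 3 :=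
      div_le_self (by positivity) hG
    linarith
  · have : 1 - 2 * q / 3 ≤ (1 + 2 * q / 3) / g ((1 - a)⁻¹ • w) := by
      rw [le_div_iff₀ hG0]
      calc (1 - 2 * q / 3) * g ((1 - a)⁻¹ • w)
          ≤ (1 - 2 * q / 3) * ((1 + 21 / 20 * q) * (1 + 2 / 9 * q)) := by
            gcongr; linarith
        _ ≤ _ := by nlinarith [mul_pos hq hq, mul_pos hq (mul_pos hq hq)]
    linarith

/-- As `q → 0` the left side tends to `2 * (41 / 20) / (14 / 3) = 123 / 140`. The term `36 * q ^ 2`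
in the radius absorbs the higher-order terms up to `q = 1 / 5`. -/
theorem stretchStep_lipschitz_bound (hq : 0 < q) (hq' : q ≤ 1 / 5) :
    (1 + 2 * q / 3) * (((1 + 21 / 20 * q) * (1 + q) - 1) /
      (6 * q + 36 * q ^ 2 - 4 * q / 3 * (1 + q)) * (2 * (1 + q) ^ 2)) ≤ 9 / 10 := by
  have hS : 0 < 6 * q + 36 * q ^ 2 - 4 * q / 3 * (1 + q) := by nlinarith
  rw [div_mul_eq_mul_div, mul_div_assoc', div_le_iff₀ hS]
  have e : (1 + 21 / 20 * q) * (1 + q) - 1 = q * (41 / 20 + 21 / 20 * q) := by ring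
  have e2 : 6 * q + 36 * q ^ 2 - 4 * q / 3 * (1 + q) = q * (14 / 3 + 104 / 3 * q) := by ring
  rw [e, e2]
  have : (1 + 2 * q / 3) * ((41 / 20 + 21 / 20 * q) * (2 * (1 + q) ^ 2))
      ≤ 9 / 10 * (14 / 3 + 104 / 3 * q) := by
    have h2 : q ^ 2 ≤ q * (1 / 5) := by nlinarith
    have h3 : q ^ 3 ≤ q * (1 / 25) := by nlinarith
    have h4 : q ^ 4 ≤ q * (1 / 125) := by nlinarith
    nlinarith
  nlinarith

theorem abs_stretchStep_sub_le (hg : ConvexOn ℝ Set.univ g) (hq : 0 < q) (hq' : q ≤ 1 / 5)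
    (h1 : ∀ w, 1 ≤ g w)
    (hB : ∀ w, ‖w‖ ≤ 6 * q + 36 * q ^ 2 → g w ≤ (1 + 21 / 20 * q) * (1 + q))
    {a a' : ℝ} {w w' : E} (ha : |a| ≤ 2 * q / 3) (ha' : |a'| ≤ 2 * q / 3)
    (hw : ‖w‖ ≤ 4 * q / 3) (hw' : ‖w'‖ ≤ 4 * q / 3) {δ : ℝ} (haδ : |a' - a| ≤ δ)
    (hwδ : ‖w' - w‖ ≤ 2 * δ) :
    |stretchStep g q a' w' - stretchStep g q a w| ≤ 9 / 10 * δ := by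
  have hn := norm_inv_one_sub_smul_le hq hq' ha hw
  have hn' := norm_inv_one_sub_smul_le hq hq' ha' hw'
  have hL := hg.abs_sub_le_of_norm_le (by nlinarith) h1 hB hn hn'
  set x := (1 - a)⁻¹ • w with hx
  set x' := (1 - a')⁻¹ • w' with hx'
  have hδ : 0 ≤ δ := (abs_nonneg _).trans haδ
  have hp : 0 < 1 - a := by linarith [(abs_le.1 ha).2]
  have hp' : 0 < 1 - a' := by linarith [(abs_le.1 ha').2]
  have hi : (1 - a)⁻¹ ≤ 1 + q := by
    rw [inv_le_iff_one_le_mul₀ hp]; nlinarith [(abs_le.1 ha).2]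
  have hxx : ‖x' - x‖ ≤ 2 * (1 + q) ^ 2 * δ := by
    -- This separates the change of `w` from the change of `a`, the latter weighted only by the
    -- small vector `x'`.
    have e : x' - x = (1 - a)⁻¹ • ((w' - w) + (a' - a) • x') := by
      have hw'x : w' = (1 - a') • x' := by rw [hx', smul_smul, mul_inv_cancel₀ hp'.ne', one_smul]
      have : (w' - w) + (a' - a) • x' = (1 - a) • x' - w := by rw [hw'x]; module
      rw [this, smul_sub, smul_smul, inv_mul_cancel₀ hp.ne', one_smul]
    rw [e, norm_smul, Real.norm_of_nonneg (by positivity)]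
    have h2 : ‖(w' - w) + (a' - a) • x'‖ ≤ 2 * δ + δ * (4 * q / 3 * (1 + q)) := by
      refine (norm_add_le _ _).trans (add_le_add hwδ ?_)
      rw [norm_smul]
      exact mul_le_mul haδ hn' (norm_nonneg _) hδ
    calc (1 - a)⁻¹ * ‖(w' - w) + (a' - a) • x'‖
        ≤ (1 + q) * (2 * δ + δ * (4 * q / 3 * (1 + q))) := by gcongr
      _ = (1 + q) * (2 + 4 * q / 3 * (1 + q)) * δ := by ring
      _ ≤ (1 + q) * (2 * (1 + q)) * δ := by gcongr; nlinarith
      _ = _ := by ring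
  have hgx := h1 x
  have hgx' := h1 x'
  have e : stretchStep g q a' w' - stretchStep g q a w
      = (1 + 2 * q / 3) * (g x' - g x) / (g x' * g x) := by
    have : g x ≠ 0 := by linarith
    have : g x' ≠ 0 := by linarith
    simp only [stretchStep, ← hx, ← hx']
    field_simp
    ring
  have hden : 0 < 6 * q + 36 * q ^ 2 - 4 * q / 3 * (1 + q) := by nlinarith
  rw [e, abs_div, abs_mul, abs_of_pos (by positivity : 0 < 1 + 2 * q / 3),
    abs_of_pos (by positivity : 0 < g x' * g x)]
  calc (1 + 2 * q / 3) * |g x' - g x| / (g x' * g x)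
      ≤ (1 + 2 * q / 3) * |g x' - g x| := div_le_self (by positivity) (by nlinarith)
    _ ≤ (1 + 2 * q / 3) * (((1 + 21 / 20 * q) * (1 + q) - 1) /
      (6 * q + 36 * q ^ 2 - 4 * q / 3 * (1 + q)) * (2 * (1 + q) ^ 2 * δ)) := by
        gcongr
        refine hL.trans (mul_le_mul_of_nonneg_left hxx (div_nonneg ?_ hden.le))
        nlinarith
    _ = (1 + 2 * q / 3) * (((1 + 21 / 20 * q) * (1 + q) - 1) /
      (6 * q + 36 * q ^ 2 - 4 * q / 3 * (1 + q)) * (2 * (1 + q) ^ 2)) * δ := by ring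
    _ ≤ _ := mul_le_mul_of_nonneg_right (stretchStep_lipschitz_bound hq hq') hδ

end StretchStep

/-! ### Perturbed basis vectors and the fixed point. -/

/-- The linear projection that sets the coordinates `i` and `j` to zero. -/
def zeroCoords {ι : Type*} [DecidableEq ι] (i j : ι) : (ι → ℝ) →ₗ[ℝ] (ι → ℝ) where
  toFun w k := if k = i ∨ k = j then 0 else w k
  map_add' x y := by ext k; by_cases h : k = i ∨ k = j <;> simp [h]
  map_smul' c x := by ext k; by_cases h : k = i ∨ k = j <;> simp [h]

theorem zeroCoords_apply {ι : Type*} [DecidableEq ι] (i j k : ι) (w : ι → ℝ) :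
    zeroCoords i j w k = if k = i ∨ k = j then 0 else w k := rfl

theorem norm_zeroCoords_le {ι : Type*} [Fintype ι] [DecidableEq ι] (i j : ι) (w : ι → ℝ) :
    ‖zeroCoords i j w‖ ≤ ‖w‖ := by
  refine (pi_norm_le_iff_of_nonneg (norm_nonneg _)).2 fun k => ?_
  rw [zeroCoords_apply]
  split_ifs
  · simp
  · exact norm_le_pi_norm w k

theorem zeroCoords_comm {ι : Type*} [DecidableEq ι] (i j : ι) :
    zeroCoords i j = zeroCoords j i := by
  ext w k; simp [zeroCoords_apply, or_comm]

/-- The difference of the perturbed basis vectors `e i + a i` and `e j + a j`. -/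
theorem single_add_sub_single_add {ι : Type*} [DecidableEq ι] {a : ι → ι → ℝ}
    (hsymm : ∀ i j, a i j = a j i) (hdiag : ∀ i, a i i = 0) {i j : ι} (hij : i ≠ j)
    (ha : 1 - a i j ≠ 0) :
    (Pi.single i 1 + a i) - (Pi.single j 1 + a j) = (1 - a i j) • ((Pi.single i 1 - Pi.single j 1)
      + zeroCoords i j ((1 - a i j)⁻¹ • (a i - a j))) := by
  rw [map_smul, smul_add, smul_smul, mul_inv_cancel₀ ha, one_smul]
  ext k
  simp only [Pi.add_apply, Pi.sub_apply, Pi.smul_apply, smul_eq_mul, zeroCoords_apply]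
  by_cases hki : k = i
  · subst hki
    simp [hdiag, hij, hsymm j k]
    try ring
  · by_cases hkj : k = j
    · subst hkj
      simp [hdiag, hki]
    · simp [hki, hkj]

/-- Banach's fixed point theorem on symmetric, zero-diagonal matrices of sup norm at most `2 * q /
3`; a fixed point makes all distances equal to `1 + 2 * q / 3`. -/
theorem exists_equidistant_image {ι Y : Type*} [Fintype ι] [DecidableEq ι]
    [NormedAddCommGroup Y] [NormedSpace ℝ Y] (L : (ι → ℝ) →ₗ[ℝ] Y) {q : ℝ} (hq : 0 < q)
    (hq' : q ≤ 1 / 5)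
    (h1 : ∀ i j, i ≠ j → ∀ w,
      1 ≤ ‖L (Pi.single i 1 - Pi.single j 1 + zeroCoords i j w)‖)
    (h0 : ∀ i j, i ≠ j → ‖L (Pi.single i 1 - Pi.single j 1)‖ ≤ 1 + 21 / 20 * q)
    (hB : ∀ i j, i ≠ j → ∀ w, ‖w‖ ≤ 6 * q + 36 * q ^ 2 →
      ‖L (Pi.single i 1 - Pi.single j 1 + zeroCoords i j w)‖ ≤ (1 + 21 / 20 * q) * (1 + q)) :
    ∃ (p : ι → Y) (K : ℝ), 0 < K ∧ ∀ i j, i ≠ j → ‖p i - p j‖ = K := by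
  set g : ι → ι → (ι → ℝ) → ℝ :=
    fun i j w => ‖L (Pi.single i 1 - Pi.single j 1 + zeroCoords i j w)‖ with hg
  have hconv : ∀ i j, ConvexOn ℝ Set.univ (g i j) := by
    intro i j
    refine ⟨convex_univ, fun x _ y _ s t hs ht hst => ?_⟩
    have e : Pi.single i 1 - Pi.single j 1 + zeroCoords i j (s • x + t • y)
        = s • (Pi.single i 1 - Pi.single j 1 + zeroCoords i j x)
          + t • (Pi.single i 1 - Pi.single j 1 + zeroCoords i j y) := by
      rw [map_add, map_smul, map_smul]
      have : (Pi.single i 1 - Pi.single j 1 : ι → ℝ)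
        = (s + t) • (Pi.single i 1 - Pi.single j 1) := by rw [hst, one_smul]
      nth_rewrite 1 [this]
      module
    simp only [hg]
    rw [e, map_add, map_smul, map_smul]
    refine (norm_add_le _ _).trans ?_
    rw [norm_smul, norm_smul, Real.norm_of_nonneg hs, Real.norm_of_nonneg ht]
    rfl
  have h0' : ∀ i j, i ≠ j → g i j 0 ≤ 1 + 21 / 20 * q := fun i j hij => by
    simpa [hg] using h0 i j hij
  set Φ : (ι → ι → ℝ) → (ι → ι → ℝ) := fun a i j =>
    if i = j then 0 else stretchStep (g i j) q (a i j) (a i - a j) with hΦ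
  set s : Set (ι → ι → ℝ) :=
    {a | ‖a‖ ≤ 2 * q / 3 ∧ (∀ i j, a i j = a j i) ∧ ∀ i, a i i = 0} with hs
  have hcomp : IsComplete s := by
    refine IsClosed.isComplete ?_
    have hc1 : IsClosed {a : ι → ι → ℝ | ∀ i j, a i j = a j i} := by
      simp only [Set.ofPred_forall]
      exact isClosed_iInter fun i => isClosed_iInter fun j =>
        isClosed_eq (by fun_prop) (by fun_prop)
    have hc2 : IsClosed {a : ι → ι → ℝ | ∀ i, a i i = 0} := by
      simp only [Set.ofPred_forall]
      exact isClosed_iInter fun i => isClosed_eq (by fun_prop) (by fun_prop)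
    exact (isClosed_le continuous_norm continuous_const).inter (hc1.inter hc2)
  have hrow : ∀ (a : ι → ι → ℝ) i, ‖a i‖ ≤ ‖a‖ := norm_le_pi_norm
  have hentry : ∀ (a : ι → ι → ℝ) i j, |a i j| ≤ ‖a‖ := fun a i j =>
    (norm_le_pi_norm (a i) j).trans (hrow a i)
  have hdiff : ∀ (a : ι → ι → ℝ) i j, ‖a i - a j‖ ≤ 2 * ‖a‖ := fun a i j =>
    (norm_sub_le _ _).trans (by linarith [hrow a i, hrow a j])
  have hmaps : Set.MapsTo Φ s s := by
    rintro a ⟨han, has, had⟩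
    refine ⟨?_, fun i j => ?_, fun i => by simp [hΦ]⟩
    · refine (pi_norm_le_iff_of_nonneg (by positivity)).2 fun i =>
        (pi_norm_le_iff_of_nonneg (by positivity)).2 fun j => ?_
      simp only [hΦ]
      split_ifs with hij
      · simp; positivity
      · exact abs_stretchStep_le (hconv i j) hq hq' (h1 i j hij) (h0' i j hij) (hB i j hij)
          ((hentry a i j).trans han) ((hdiff a i j).trans (by linarith))
    · simp only [hΦ]
      by_cases hij : i = j
      · simp [hij]
      · have hji : ¬ j = i := fun h => hij h.symm
        simp only [if_neg hij, if_neg hji, stretchStep, hg]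
        -- Swapping `i` and `j` negates the vector inside the norm, so symmetry of the matrix is
        -- preserved.
        rw [has j i, zeroCoords_comm j i, ← neg_sub (a i) (a j), smul_neg, map_neg,
          ← neg_sub (Pi.single i 1) (Pi.single j 1), ← neg_add, map_neg, norm_neg]
  have hlip : ContractingWith (9 / 10) (hmaps.restrict Φ s s) := by
    refine ⟨by rw [← NNReal.coe_lt_coe]; norm_num, LipschitzWith.of_dist_le_mul ?_⟩
    rintro ⟨a', han', -, -⟩ ⟨a, han, -, -⟩
    rw [Subtype.dist_eq, Subtype.dist_eq]
    simp only [Set.MapsTo.val_restrict_apply]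
    rw [dist_eq_norm, dist_eq_norm]
    push_cast
    refine (pi_norm_le_iff_of_nonneg (by positivity)).2 fun i =>
      (pi_norm_le_iff_of_nonneg (by positivity)).2 fun j => ?_
    simp only [hΦ, Pi.sub_apply]
    split_ifs with hij
    · simp
    · refine abs_stretchStep_sub_le (hconv i j) hq hq' (h1 i j hij) (hB i j hij)
        ((hentry a i j).trans han) ((hentry a' i j).trans han')
        ((hdiff a i j).trans (by linarith)) ((hdiff a' i j).trans (by linarith))
        (hentry (a' - a) i j) ?_
      have : a' i - a' j - (a i - a j) = (a' - a) i - (a' - a) j := by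
        simp only [Pi.sub_apply]; abel
      rw [this]
      exact hdiff _ _ _
  obtain ⟨a, ⟨han, has, had⟩, hfix, -⟩ := ContractingWith.exists_fixedPoint' hcomp hmaps hlip
    (x := 0) ⟨by simp; positivity, by simp, by simp⟩ (edist_ne_top _ _)
  refine ⟨fun i => L (Pi.single i 1 + a i), 1 + 2 * q / 3, by positivity, fun i j hij => ?_⟩
  have hpos : 0 < 1 - a i j := by
    linarith [(abs_le.1 ((hentry a i j).trans han)).2]
  have hij' : a i j = stretchStep (g i j) q (a i j) (a i - a j) := by
    have := congrFun (congrFun hfix i) j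
    simp only [hΦ, if_neg hij] at this
    exact this.symm
  have hgpos := h1 i j hij ((1 - a i j)⁻¹ • (a i - a j))
  rw [← map_sub, single_add_sub_single_add has had hij hpos.ne', map_smul, norm_smul,
    Real.norm_of_nonneg hpos.le]
  rw [stretchStep] at hij'
  have h2 : 1 - a i j = (1 + 2 * q / 3) / g i j ((1 - a i j)⁻¹ • (a i - a j)) := by linarith
  have h3 : g i j ((1 - a i j)⁻¹ • (a i - a j)) ≠ 0 := by
    have : 1 ≤ g i j ((1 - a i j)⁻¹ • (a i - a j)) := hgpos
    linarith
  exact (eq_div_iff h3).1 h2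

/-! ### The modulus of smoothness. -/

open Filter Topology

theorem smoothnessModulus_div_le {X : Type*} [NormedAddCommGroup X] [NormedSpace ℝ X] {t δ : ℝ}
    (ht : 0 < t) (h : ∀ x y : X, ‖x‖ ≤ 1 → ‖y‖ ≤ 1 →
      (‖x + t • y‖ + ‖x - t • y‖) / 2 - 1 ≤ t * δ) :
    smoothnessModulus X t / t ≤ δ := by
  rw [div_le_iff₀ ht, mul_comm]
  refine csSup_le ⟨_, 0, 0, by simp, by simp, rfl⟩ ?_
  rintro _ ⟨x, y, hx, hy, rfl⟩
  exact h x y hx hy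

theorem le_smoothnessModulus {X : Type*} [NormedAddCommGroup X] [NormedSpace ℝ X] (t : ℝ)
    {x y : X} (hx : ‖x‖ ≤ 1) (hy : ‖y‖ ≤ 1) :
    (‖x + t • y‖ + ‖x - t • y‖) / 2 - 1 ≤ smoothnessModulus X t := by
  refine le_csSup ⟨|t|, ?_⟩ ⟨x, y, hx, hy, rfl⟩
  rintro _ ⟨x, y, hx, hy, rfl⟩
  have h1 := norm_add_le x (t • y)
  have h2 := norm_sub_le x (t • y)
  rw [norm_smul, Real.norm_eq_abs] at h1 h2
  nlinarith [abs_nonneg t]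

theorem IsSmoothSpace.eq_of_norm_le {X : Type*} [NormedAddCommGroup X] [NormedSpace ℝ X]
    (h : IsSmoothSpace X) {x : X} (hx : ‖x‖ = 1) {f g : X →L[ℝ] ℝ} (hf : ‖f‖ ≤ 1) (hg : ‖g‖ ≤ 1)
    (hfx : f x = 1) (hgx : g x = 1) : f = g := by
  refine (h x hx).unique ⟨hfx, fun y hy => ?_⟩ ⟨hgx, fun y hy => ?_⟩
  · exact (f.le_of_opNorm_le_of_le hf hy).trans (by norm_num)
  · exact (g.le_of_opNorm_le_of_le hg hy).trans (by norm_num)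

theorem tendsto_clm_apply {α X : Type*} [NormedAddCommGroup X] [NormedSpace ℝ X] {l : Filter α}
    {F : α → X →L[ℝ] ℝ} {x : α → X} {f : X →L[ℝ] ℝ} {y : X} (hF : Tendsto F l (𝓝 f))
    (hx : Tendsto x l (𝓝 y)) : Tendsto (fun a => F a (x a)) l (𝓝 (f y)) :=
  (isBoundedBilinearMap_apply.continuous.tendsto (f, y)).comp (hF.prodMk_nhds hx)

/-- A smooth finite-dimensional space is uniformly smooth. -/
theorem IsSmoothSpace.exists_smoothnessModulus_div_le {X : Type*} [NormedAddCommGroup X]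
    [NormedSpace ℝ X] [FiniteDimensional ℝ X] (h : IsSmoothSpace X) {δ : ℝ} (hδ : 0 < δ) :
    ∃ t : ℝ, 0 < t ∧ smoothnessModulus X t / t ≤ δ := by
  -- Otherwise each `t = 1 / (k + 1)` has a bad pair `x, y`; add norming functionals of `x + t • y`
  -- and `x - t • y` and pass to a convergent subsequence. Both limit functionals support the limit
  -- of `x`, so smoothness makes them equal.
  by_contra! hcon
  have hex : ∀ k : ℕ, ∃ z : (X × X) × ((X →L[ℝ] ℝ) × (X →L[ℝ] ℝ)),
      ‖z‖ ≤ 1 ∧ 1 / ((k : ℝ) + 1) * δ < (‖z.1.1 + (1 / ((k : ℝ) + 1)) • z.1.2‖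
        + ‖z.1.1 - (1 / ((k : ℝ) + 1)) • z.1.2‖) / 2 - 1 ∧
      z.2.1 (z.1.1 + (1 / ((k : ℝ) + 1)) • z.1.2) = ‖z.1.1 + (1 / ((k : ℝ) + 1)) • z.1.2‖ ∧
      z.2.2 (z.1.1 - (1 / ((k : ℝ) + 1)) • z.1.2) = ‖z.1.1 - (1 / ((k : ℝ) + 1)) • z.1.2‖ := by
    intro k
    have ht : 0 < 1 / ((k : ℝ) + 1) := by positivity
    have : ∃ x y : X, ‖x‖ ≤ 1 ∧ ‖y‖ ≤ 1 ∧ 1 / ((k : ℝ) + 1) * δ <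
        (‖x + (1 / ((k : ℝ) + 1)) • y‖ + ‖x - (1 / ((k : ℝ) + 1)) • y‖) / 2 - 1 := by
      by_contra! hno
      exact (hcon _ ht).not_ge (smoothnessModulus_div_le ht fun x y hx hy => hno x y hx hy)
    obtain ⟨x, y, hx, hy, hxy⟩ := this
    obtain ⟨f, hf, hfx⟩ := exists_dual_vector'' ℝ (x + (1 / ((k : ℝ) + 1)) • y)
    obtain ⟨g, hg, hgx⟩ := exists_dual_vector'' ℝ (x - (1 / ((k : ℝ) + 1)) • y)
    refine ⟨((x, y), (f, g)), ?_, hxy, by simpa using hfx, by simpa using hgx⟩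
    simp [Prod.norm_def, hx, hy, hf, hg]
  choose z hz hlt hf hg using hex
  have : ProperSpace X := FiniteDimensional.proper ℝ X
  have : ProperSpace (X →L[ℝ] ℝ) := FiniteDimensional.proper ℝ _
  obtain ⟨w, hw, φ, hφ, hlim⟩ := tendsto_subseq_of_bounded
    (Metric.isBounded_closedBall (x := (0 : (X × X) × ((X →L[ℝ] ℝ) × (X →L[ℝ] ℝ)))) (r := 1))
    (x := z) (fun k => by simpa using hz k)
  rw [Metric.isClosed_closedBall.closure_eq, mem_closedBall_zero_iff] at hw
  simp only [Prod.norm_def, sup_le_iff] at hw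
  obtain ⟨⟨hx1, hy1⟩, hf1, hg1⟩ := hw
  have ht : Tendsto (fun k => 1 / ((φ k : ℝ) + 1)) atTop (𝓝 0) :=
    (tendsto_one_div_add_atTop_nhds_zero_nat (𝕜 := ℝ)).comp hφ.tendsto_atTop
  have hX : Tendsto (fun k => (z (φ k)).1.1) atTop (𝓝 w.1.1) := hlim.fst_nhds.fst_nhds
  have hY : Tendsto (fun k => (z (φ k)).1.2) atTop (𝓝 w.1.2) := hlim.fst_nhds.snd_nhds
  have hF : Tendsto (fun k => (z (φ k)).2.1) atTop (𝓝 w.2.1) := hlim.snd_nhds.fst_nhds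
  have hG : Tendsto (fun k => (z (φ k)).2.2) atTop (𝓝 w.2.2) := hlim.snd_nhds.snd_nhds
  have hP := hX.add (ht.smul hY)
  have hM := hX.sub (ht.smul hY)
  simp only [zero_smul, add_zero, sub_zero] at hP hM
  have hfw : w.2.1 w.1.1 = ‖w.1.1‖ :=
    tendsto_nhds_unique (tendsto_clm_apply hF hP) (hP.norm.congr fun k => (hf _).symm)
  have hgw : w.2.2 w.1.1 = ‖w.1.1‖ :=
    tendsto_nhds_unique (tendsto_clm_apply hG hM) (hM.norm.congr fun k => (hg _).symm)
  have hnorm : ‖w.1.1‖ = 1 := by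
    refine le_antisymm hx1 ?_
    have := ge_of_tendsto (hP.norm.add hM.norm) (b := 2) (Eventually.of_forall fun k => by
      have h1 := hlt (φ k)
      have : 0 < 1 / ((φ k : ℝ) + 1) * δ := by positivity
      linarith)
    linarith
  -- Both functionals are at most `1` at `x`, which cancels the `-1` in the modulus; what is left is
  -- divided by `t`.
  have hgap : 2 * δ ≤ w.2.1 w.1.2 - w.2.2 w.1.2 := by
    refine ge_of_tendsto ((tendsto_clm_apply hF hY).sub (tendsto_clm_apply hG hY)) (Eventually.of_forall fun k => ?_)
    have h1 := hlt (φ k)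
    have h2 := hf (φ k)
    have h3 := hg (φ k)
    have hz' := hz (φ k)
    simp only [Prod.norm_def, sup_le_iff] at hz'
    obtain ⟨⟨hxk, -⟩, hfk, hgk⟩ := hz'
    have h4 : (z (φ k)).2.1 (z (φ k)).1.1 ≤ 1 :=
      (le_abs_self _).trans (((z (φ k)).2.1.le_of_opNorm_le_of_le hfk hxk).trans (by norm_num))
    have h5 : (z (φ k)).2.2 (z (φ k)).1.1 ≤ 1 :=
      (le_abs_self _).trans (((z (φ k)).2.2.le_of_opNorm_le_of_le hgk hxk).trans (by norm_num))
    have hk : 0 < 1 / ((φ k : ℝ) + 1) := by positivity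
    rw [← h2, ← h3] at h1
    simp only [map_add, map_sub, map_smul, smul_eq_mul] at h1
    refine le_of_mul_le_mul_left ?_ hk
    linarith
  have := h.eq_of_norm_le hnorm hf1 hg1 (hfw.trans hnorm) (hgw.trans hnorm)
  rw [this] at hgap
  linarith

/-! ### Geometry of symmetric norms. -/

section SymmetricNorm

variable {n : ℕ} {X : Type*} [NormedAddCommGroup X] [NormedSpace ℝ X]
  {b : Module.Basis (Fin n) ℝ X}

theorem IsSymmetricNorm.norm_perm (h : IsSymmetricNorm b) (σ : Equiv.Perm (Fin n))
    (x : Fin n → ℝ) : ‖b.equivFun.symm x‖ = ‖b.equivFun.symm (x ∘ σ)‖ := by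
  simpa [Module.Basis.equivFun_symm_apply] using h.1 σ x

theorem IsSymmetricNorm.norm_sign (h : IsSymmetricNorm b) {ε : Fin n → ℝ}
    (hε : ∀ i, ε i = 1 ∨ ε i = -1) (x : Fin n → ℝ) :
    ‖b.equivFun.symm x‖ = ‖b.equivFun.symm (ε * x)‖ := by
  simpa [Module.Basis.equivFun_symm_apply] using h.2 ε hε x

theorem IsSymmetricNorm.norm_basis_eq (h : IsSymmetricNorm b) (i j : Fin n) : ‖b i‖ = ‖b j‖ := by
  have e := h.norm_perm (Equiv.swap i j) (Pi.single i 1)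
  have : (Pi.single i 1 : Fin n → ℝ) ∘ Equiv.swap i j = Pi.single j 1 := by
    ext k
    simp [Pi.single_apply, Equiv.swap_apply_eq_iff]
  rw [this] at e
  simpa [Module.Basis.equivFun_symm_apply, Pi.single_apply] using e

/-- The symmetric group is 2-transitive. -/
theorem IsSymmetricNorm.norm_single_sub_single_eq (h : IsSymmetricNorm b) {i j k l : Fin n}
    (hij : i ≠ j) (hkl : k ≠ l) :
    ‖b.equivFun.symm (Pi.single i 1 - Pi.single j 1)‖
      = ‖b.equivFun.symm (Pi.single k 1 - Pi.single l 1)‖ := by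
  obtain ⟨σ, rfl, rfl⟩ := MulAction.is_two_pretransitive_iff.1
    (Equiv.Perm.isMultiplyPretransitive (Fin n) 2) hkl hij
  rw [h.norm_perm σ]
  congr 2
  ext m
  simp [Pi.single_apply]

/-- `b i` is the midpoint of `b i - b j` and `b i + b j`, which have equal norm by a sign change. -/
theorem IsSymmetricNorm.norm_basis_le (h : IsSymmetricNorm b) {i j : Fin n} (hij : i ≠ j) :
    ‖b i‖ ≤ ‖b.equivFun.symm (Pi.single i 1 - Pi.single j 1)‖ := by
  have e := h.norm_sign (ε := fun k => if k = j then -1 else 1)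
    (fun k => by by_cases hk : k = j <;> simp [hk]) (Pi.single i 1 - Pi.single j 1)
  have e2 : (fun k => if k = j then -1 else 1) * (Pi.single i 1 - Pi.single j 1 : Fin n → ℝ)
      = Pi.single i 1 + Pi.single j 1 := by
    ext k
    by_cases hk : k = j
    · subst hk; simp [hij.symm]
    · simp [hk]
  rw [e2] at e
  have e3 : (2 : ℝ) • b i = b.equivFun.symm (Pi.single i 1 - Pi.single j 1)
      + b.equivFun.symm (Pi.single i 1 + Pi.single j 1) := by
    simp [Module.Basis.equivFun_symm_apply, Pi.single_apply, sub_smul, add_smul,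
      Finset.sum_add_distrib, Finset.sum_sub_distrib, two_smul]
  have := norm_add_le (b.equivFun.symm (Pi.single i 1 - Pi.single j 1))
    (b.equivFun.symm (Pi.single i 1 + Pi.single j 1))
  rw [← e3, ← e, norm_smul, Real.norm_two] at this
  linarith

theorem IsSymmetricNorm.norm_add_zeroCoords (h : IsSymmetricNorm b) (i j : Fin n)
    (w : Fin n → ℝ) :
    ‖b.equivFun.symm (Pi.single i 1 - Pi.single j 1 - zeroCoords i j w)‖
      = ‖b.equivFun.symm (Pi.single i 1 - Pi.single j 1 + zeroCoords i j w)‖ := by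
  rw [h.norm_sign (ε := fun k => if k = i ∨ k = j then -1 else 1)
    (fun k => by by_cases hk : k = i ∨ k = j <;> simp [hk])
    (Pi.single i 1 - Pi.single j 1 + zeroCoords i j w), ← norm_neg, ← map_neg]
  congr 2
  ext k
  simp only [Pi.neg_apply, Pi.sub_apply, Pi.mul_apply, Pi.add_apply, zeroCoords_apply]
  by_cases hk : k = i ∨ k = j
  · simp [hk]
  · have h1 : k ≠ i := fun h => hk (Or.inl h)
    have h2 : k ≠ j := fun h => hk (Or.inr h)
    simp [h1, h2]

theorem IsSymmetricNorm.norm_single_sub_single_le (h : IsSymmetricNorm b) (i j : Fin n)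
    (w : Fin n → ℝ) :
    ‖b.equivFun.symm (Pi.single i 1 - Pi.single j 1)‖
      ≤ ‖b.equivFun.symm (Pi.single i 1 - Pi.single j 1 + zeroCoords i j w)‖ := by
  have e := h.norm_add_zeroCoords i j w
  rw [map_sub _ (_ - _)] at e
  rw [map_add] at e ⊢
  generalize b.equivFun.symm (Pi.single i 1 - Pi.single j 1) = v at *
  generalize b.equivFun.symm (zeroCoords i j w) = u at *
  have := norm_add_le (v - u) (v + u)
  rw [show v - u + (v + u) = (2 : ℝ) • v by module, norm_smul, e] at this
  norm_num at this
  linarith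

theorem norm_equivFun_symm_zeroCoords_le {i j : Fin n} (hij : i ≠ j) {τ : ℝ}
    (hτ : ∀ k, ‖b k‖ ≤ τ) (w : Fin n → ℝ) :
    ‖b.equivFun.symm (zeroCoords i j w)‖ ≤ ((n : ℝ) - 2) * ‖w‖ * τ := by
  rw [Module.Basis.equivFun_symm_apply]
  have hsub : ∑ k ∈ ({i, j} : Finset (Fin n))ᶜ, zeroCoords i j w k • b k
      = ∑ k, zeroCoords i j w k • b k := by
    refine Finset.sum_subset (Finset.subset_univ _) fun k _ hk => ?_
    have : k = i ∨ k = j := by simp at hk; tauto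
    simp [zeroCoords_apply, this]
  rw [← hsub]
  have hcard : ((({i, j} : Finset (Fin n))ᶜ.card : ℕ) : ℝ) = (n : ℝ) - 2 := by
    rw [Finset.card_compl, Nat.cast_sub (Finset.card_le_univ _), Finset.card_pair hij]
    simp
  calc ‖∑ k ∈ ({i, j} : Finset (Fin n))ᶜ, zeroCoords i j w k • b k‖
      ≤ ∑ _k ∈ ({i, j} : Finset (Fin n))ᶜ, ‖w‖ * τ := by
        refine norm_sum_le_of_le _ fun k _ => ?_
        rw [norm_smul]
        exact mul_le_mul ((norm_le_pi_norm _ k).trans (norm_zeroCoords_le i j w)) (hτ k)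
          (norm_nonneg _) (norm_nonneg _)
    _ = _ := by rw [Finset.sum_const, nsmul_eq_mul, hcard]; ring

/-- With `v = b i - b j` and `u` the perturbation, `‖v + u‖ = ‖v - u‖`, so the average in the
modulus of smoothness is `‖v + u‖` itself. At most `n - 2` coordinates of `u` survive, so `‖u‖ ≤ ε *
‖v‖`. -/
theorem IsSymmetricNorm.norm_add_zeroCoords_le (h : IsSymmetricNorm b) {i j : Fin n} (hij : i ≠ j)
    {ε : ℝ} (hε : 0 < ε) {w : Fin n → ℝ} (hw : ((n : ℝ) - 2) * ‖w‖ ≤ ε) :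
    ‖b.equivFun.symm (Pi.single i 1 - Pi.single j 1 + zeroCoords i j w)‖
      ≤ ‖b.equivFun.symm (Pi.single i 1 - Pi.single j 1)‖ * (1 + smoothnessModulus X ε) := by
  have hc : 0 < ‖b.equivFun.symm (Pi.single i 1 - Pi.single j 1)‖ :=
    (norm_pos_iff.2 (b.ne_zero i)).trans_le (h.norm_basis_le hij)
  have hτ := h.norm_basis_le hij
  have hu := norm_equivFun_symm_zeroCoords_le hij (fun k => (h.norm_basis_eq k i).le) w
  have e := h.norm_add_zeroCoords i j w
  rw [map_sub _ (_ - _)] at e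
  rw [map_add] at e ⊢
  generalize b.equivFun.symm (Pi.single i 1 - Pi.single j 1) = v at *
  generalize b.equivFun.symm (zeroCoords i j w) = u at *
  have hu' : ‖u‖ ≤ ε * ‖v‖ := hu.trans (mul_le_mul hw hτ (norm_nonneg _) hε.le)
  have hρ := le_smoothnessModulus (X := X) ε (x := ‖v‖⁻¹ • v) (y := (ε * ‖v‖)⁻¹ • u)
    (by rw [norm_smul, norm_inv, norm_norm, inv_mul_cancel₀ hc.ne'])
    (by rw [norm_smul, Real.norm_of_nonneg (by positivity), inv_mul_le_iff₀ (by positivity)]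
        simpa using hu')
  have e1 : ε • (ε * ‖v‖)⁻¹ • u = ‖v‖⁻¹ • u := by
    rw [smul_smul]; congr 1; field_simp
  rw [e1, ← smul_add, ← smul_sub, norm_smul, norm_smul, e, norm_inv, norm_norm] at hρ
  have : ‖v‖⁻¹ * ‖v + u‖ ≤ 1 + smoothnessModulus X ε := by linarith
  rwa [inv_mul_le_iff₀ hc] at this

end SymmetricNorm

/-! ### Equilateral sets in spaces close to `X`. -/

theorem le_equilateralDim_of_norm_sub_eq {n : ℕ} {Y : Type*} [NormedAddCommGroup Y] {p : Fin n → Y}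
    {K : ℝ} (hK : 0 < K) (h : ∀ i j, i ≠ j → ‖p i - p j‖ = K) : (n : ℕ∞) ≤ equilateralDim Y := by
  have hinj : Function.Injective p := by
    intro i j hij
    by_contra hne
    have := h i j hne
    rw [hij] at this
    simp at this
    linarith
  have heq : IsEquilateral (Set.range p) := by
    refine ⟨K, hK, ?_⟩
    rintro _ ⟨i, rfl⟩ _ ⟨j, rfl⟩ hne
    exact h i j fun hij => hne (by rw [hij])
  have hcard : (Set.range p).encard = n := by
    rw [← Set.image_univ, hinj.encard_image]; simp
  rw [← hcard]
  exact le_iSup₂ (f := fun (S : Set Y) (_ : IsEquilateral S) => S.encard) _ heq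

/-- Taking `x = 0` and `y` a unit vector gives `ρ_X(ε) ≥ ε - 1`. The bound keeps `q = ε / (6 * n)`
at most `1 / 5` and the set of admissible `ε` bounded. -/
theorem le_of_smoothnessModulus_div_le {n : ℕ} (hn : 1 ≤ n) {X : Type*} [NormedAddCommGroup X]
    [NormedSpace ℝ X] [Nontrivial X] {ε : ℝ} (hε : 0 < ε)
    (h : smoothnessModulus X ε / ε ≤ 1 / (6 * (n : ℝ))) : ε ≤ 6 / 5 := by
  have hn' : (1 : ℝ) ≤ n := by exact_mod_cast hn
  obtain ⟨y, hy⟩ := exists_norm_eq X (zero_le_one (α := ℝ))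
  have h1 := le_smoothnessModulus (X := X) ε (x := 0) (y := y) (by simp) hy.le
  simp only [zero_add, zero_sub, norm_neg, norm_smul, hy, Real.norm_of_nonneg hε.le] at h1
  have h2 : (1 : ℝ) / (6 * n) ≤ 1 / 6 := by gcongr; linarith
  have h3 := (div_le_iff₀ hε).1 (h.trans h2)
  linarith

theorem le_equilateralDim_of_norm_mul_norm_symm_le {n : ℕ} (hn : 1 ≤ n) {X : Type*}
    [NormedAddCommGroup X] [NormedSpace ℝ X] {b : Module.Basis (Fin n) ℝ X}
    (hsymm : IsSymmetricNorm b) {ε : ℝ} (hε : 0 < ε)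
    (hρ : smoothnessModulus X ε / ε ≤ 1 / (6 * (n : ℝ))) {Y : Type*} [NormedAddCommGroup Y]
    [NormedSpace ℝ Y] (T : X ≃L[ℝ] Y)
    (hT : ‖(T : X →L[ℝ] Y)‖ * ‖(T.symm : Y →L[ℝ] X)‖ ≤ 1 + 21 / 20 * (ε / (6 * n))) :
    (n : ℕ∞) ≤ equilateralDim Y := by
  have hn' : (1 : ℝ) ≤ n := by exact_mod_cast hn
  have : Nontrivial X := ⟨b ⟨0, hn⟩, 0, b.ne_zero _⟩
  have hε' := le_of_smoothnessModulus_div_le hn hε hρ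
  set q := ε / (6 * (n : ℝ)) with hq
  have hq0 : 0 < q := by positivity
  have hqn : ε = 6 * n * q := by rw [hq]; field_simp
  have hq5 : q ≤ 1 / 5 := by
    rw [hq, div_le_iff₀ (by positivity)]; linarith
  have hρq : smoothnessModulus X ε ≤ q := by
    rw [div_le_iff₀ hε] at hρ
    rw [hq]; linarith [hρ, one_div_mul_eq_div (6 * (n : ℝ)) ε]
  obtain ⟨c, hc, hcv⟩ : ∃ c : ℝ, 0 < c ∧ ∀ i j : Fin n, i ≠ j →
      ‖b.equivFun.symm (Pi.single i 1 - Pi.single j 1)‖ = c := by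
    by_cases hex : ∃ i j : Fin n, i ≠ j
    · obtain ⟨i, j, hij⟩ := hex
      exact ⟨_, (norm_pos_iff.2 (b.ne_zero i)).trans_le (hsymm.norm_basis_le hij),
        fun k l hkl => hsymm.norm_single_sub_single_eq hkl hij⟩
    · push Not at hex
      -- For `n = 1` there are no pairs, and any positive `c` serves.
      exact ⟨1, one_pos, fun i j hij => absurd (hex i j) hij⟩
  set r := ‖(T.symm : Y →L[ℝ] X)‖ with hr
  have hlow : ∀ x, ‖x‖ ≤ r * ‖T x‖ := fun x => by
    simpa using (T.symm : Y →L[ℝ] X).le_opNorm (T x)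
  have hup : ∀ x, r * ‖T x‖ ≤ (1 + 21 / 20 * q) * ‖x‖ := fun x => by
    calc r * ‖T x‖ ≤ r * (‖(T : X →L[ℝ] Y)‖ * ‖x‖) := by
          gcongr; exact (T : X →L[ℝ] Y).le_opNorm x
      _ = ‖(T : X →L[ℝ] Y)‖ * r * ‖x‖ := by ring
      _ ≤ _ := by gcongr
  -- Scaled so that the smallest possible distance becomes `1`: `‖x‖ ≤ r * ‖T x‖`, and `c` is the
  -- common distance in `X`.
  set L : (Fin n → ℝ) →ₗ[ℝ] Y :=
    (r / c) • (T.toLinearEquiv.toLinearMap ∘ₗ b.equivFun.symm.toLinearMap) with hL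
  have hLx : ∀ x, ‖L x‖ = r * ‖T (b.equivFun.symm x)‖ / c := fun x => by
    simp only [hL, LinearMap.smul_apply, norm_smul, Real.norm_of_nonneg (div_nonneg (norm_nonneg _)
      hc.le : 0 ≤ r / c)]
    rw [div_mul_eq_mul_div]; rfl
  obtain ⟨p, K, hK, hp⟩ := exists_equidistant_image L hq0 hq5
    (fun i j hij w => by
      rw [hLx, le_div_iff₀ hc, one_mul, ← hcv i j hij]
      exact (hsymm.norm_single_sub_single_le i j w).trans (hlow _))
    (fun i j hij => by
      rw [hLx, div_le_iff₀ hc, ← hcv i j hij]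
      exact hup _)
    (fun i j hij w hw => by
      rw [hLx, div_le_iff₀ hc]
      refine (hup _).trans ?_
      rw [mul_assoc]
      refine mul_le_mul_of_nonneg_left ?_ (by positivity)
      have hn2 : (2 : ℝ) ≤ n := by
        have := Finset.card_le_univ ({i, j} : Finset (Fin n))
        rw [Finset.card_pair hij, Fintype.card_fin] at this
        exact_mod_cast this
      refine (hsymm.norm_add_zeroCoords_le hij hε ?_).trans ?_
      · refine (mul_le_mul_of_nonneg_left hw (by linarith)).trans ?_
        -- `(n - 2) * (6 * q + 36 * q ^ 2) ≤ 6 * n * q` reduces to `36 * n * q ^ 2 ≤ 12 * q + 72 * q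
        -- ^ 2`, which `n * q ≤ 1 / 5` ensures.
        have h6 : (n : ℝ) * q ≤ 1 / 5 := by linarith
        nlinarith [mul_le_mul_of_nonneg_right h6 hq0.le, mul_pos hq0 hq0]
      · rw [hcv i j hij, mul_comm]
        gcongr)
  exact le_equilateralDim_of_norm_sub_eq hK hp

theorem theorem1p5 {n : ℕ} (hn : 1 ≤ n) {X : Type*} [NormedAddCommGroup X] [NormedSpace ℝ X]
    (b : Module.Basis (Fin n) ℝ X) (hsymm : IsSymmetricNorm b) (hsmooth : IsSmoothSpace X) :
    (∃ ε₀ : ℝ, 0 < ε₀ ∧ smoothnessModulus X ε₀ / ε₀ ≤ 1 / (6 * (n : ℝ))) ∧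
    ∃ R : ℝ, 1 < R ∧
      (∀ (Y : Type*) [NormedAddCommGroup Y] [NormedSpace ℝ Y],
        banachMazurDist X Y ≤ ENNReal.ofReal R → (n : ℕ∞) ≤ equilateralDim Y) ∧
      ∀ ε₀ : ℝ, 0 < ε₀ → smoothnessModulus X ε₀ / ε₀ ≤ 1 / (6 * (n : ℝ)) →
        1 + ε₀ / (6 * (n : ℝ)) ≤ R := by
  have hn' : (0 : ℝ) < n := by exact_mod_cast hn
  have : FiniteDimensional ℝ X := b.finiteDimensional_of_finite
  have : Nontrivial X := ⟨b ⟨0, hn⟩, 0, b.ne_zero _⟩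
  have hex := hsmooth.exists_smoothnessModulus_div_le (δ := 1 / (6 * (n : ℝ))) (by positivity)
  set A := {ε : ℝ | 0 < ε ∧ smoothnessModulus X ε / ε ≤ 1 / (6 * (n : ℝ))} with hA
  have hbdd : BddAbove A := ⟨6 / 5, fun ε hε => le_of_smoothnessModulus_div_le hn hε.1 hε.2⟩
  have hs : 0 < sSup A := by
    obtain ⟨ε, hε⟩ := hex
    exact hε.1.trans_le (le_csSup hbdd hε)
  -- One `R` must serve every admissible `ε₀`, hence the supremum.
  refine ⟨hex, 1 + sSup A / (6 * n), by linarith [show 0 < sSup A / (6 * n) by positivity], ?_, ?_⟩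
  · intro Y _ _ hd
    -- Neither the supremum nor the infimum defining the distance need be attained; the slack `21 /
    -- 20` carried through the estimates covers both.
    obtain ⟨ε, hεA, hε⟩ := exists_lt_of_lt_csSup hex (show 20 / 21 * sSup A < sSup A by linarith)
    have hε0 : 0 < ε := hεA.1
    have hlt : banachMazurDist X Y < ENNReal.ofReal (1 + 21 / 20 * (ε / (6 * n))) := by
      refine hd.trans_lt ((ENNReal.ofReal_lt_ofReal_iff (by positivity)).2 ?_)
      rw [mul_div_assoc']
      gcongr
      linarith
    obtain ⟨T, hT⟩ := iInf_lt_iff.1 hlt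
    exact le_equilateralDim_of_norm_mul_norm_symm_le hn hsymm hε0 hεA.2 T
      ((ENNReal.ofReal_lt_ofReal_iff (by positivity)).1 hT).le
  · intro ε hε hρ
    have := le_csSup hbdd (show ε ∈ A from ⟨hε, hρ⟩)
    gcongr
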